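/- \textbf{Theorem (soundness and completeness of $\mathbf{GA_s}$).} Formulas are built from propositional variables $p_0,p_1,\dots$ with the connectives $t$ (constant), $\lnot$ (unary), $+$, $\to$ and $\Rightarrow$ (binary); $A\land B$ and $A\lor B$ abbreviate $A+(A\Rightarrow B)$ and $(B\Rightarrow A)\to A$. A valuation $v$ in a lattice-ordered abelian group $G$ maps variables to elements of $G$ and is extended to formulas by $v(t)=0$, $v(\lnot A)=-v(A)$, $v(A+B)=v(A)+v(B)$, $v(A\to B)=-v(A)+v(B)$, $v(A\Rightarrow B)=(-v(A)+v(B))\land 0$ (so that $A\land B$ and $A\lor B$ are interpreted as meet and join). A formula is valid, $\models_A\phi$, if $v(\phi)\ge 0$ for every valuation $v$ in every lattice-ordered abelian group. A sequent $\Gamma\vdash\Delta$ is an ordered pair of finite multisets of formulas; $S = A_1,\dots,A_n\vdash B_1,\dots,B_m$ is valid, $\models_A S$, if the formula $(A_1+\dots+A_n)\to(B_1+\dots+B_m)$ is valid, where an empty sum is $t$. The calculus $\mathbf{GA_s}$ has the axioms $(ID)$ $A\vdash A$ and $(\Lambda)$ $\vdash$ (the empty sequent), and the following rules, for all formulas $A,B$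 and all finite multisets $\Gamma,\Delta,\Gamma_i,\Delta_i$ of formulas. Structural rules: \begin{itemize} \item $(W)$ from $\Gamma\vdash\Delta$ infer $\Gamma,A\Rightarrow B\vdash\Delta$; \item $(M)$ from $\Gamma_1\vdash\Delta_1$ and $\Gamma_2\vdash\Delta_2$ infer $\Gamma_1,\Gamma_2\vdash\Delta_1,\Delta_2$; \item $(C)$ from $\underbrace{\Gamma,\dots,\Gamma}_n\vdash\underbrace{\Delta,\dots,\Delta}_n$ infer $\Gamma\vdash\Delta$, for any integer $n>0$. \end{itemize} Logical rules: \begin{itemize} \item $(t,l)$ from $\Gamma\vdash\Delta$ infer $\Gamma,t\vdash\Delta$; $(t,r)$ from $\Gamma\vdash\Delta$ infer $\Gamma\vdash t,\Delta$; \item $(\lnot,l)$ from $\Gamma\vdash A,\Delta$ infer $\Gamma,\lnot A\vdash\Delta$; $(\lnot,r)$ from $\Gamma,A\vdash\Delta$ infer $\Gamma\vdash\lnot A,\Delta$; \item $(\to,l)$ from $\Gamma,B\vdash A,\Delta$ infer $\Gamma,A\to B\vdash\Delta$; $(\to,r)$ from $\Gamma,A\vdash B,\Delta$ infer $\Gamma\vdash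 A\to B,\Delta$; \item $(+,l)$ from $\Gamma,A,B\vdash\Delta$ infer $\Gamma,A+B\vdash\Delta$; $(+,r)$ from $\Gamma\vdash A,B,\Delta$ infer $\Gamma\vdash A+B,\Delta$; \item $(\Rightarrow,l)$ from $\Gamma,B,B\Rightarrow A\vdash\Delta,A$ infer $\Gamma,A\Rightarrow B\vdash\Delta$; $(\Rightarrow,r)$ from $\Gamma\vdash\Delta$ and $\Gamma,A\vdash\Delta,B$ infer $\Gamma\vdash\Delta,A\Rightarrow B$. \end{itemize} Then for every sequent $S$: $S$ is provable in $\mathbf{GA_s}$ if and only if $\models_A S$. -/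

import Mathlib

universe u

namespace AbelianLogic

/-- Formulas over the variables `p₀, p₁, …`, with primitive connectives
`t`, `¬`, `+`, `→` and `⇒` (positive implication). -/
inductive Formula : Type
  | var : ℕ → Formula
  | t : Formula
  | neg : Formula → Formula
  | add : Formula → Formula → Formula
  | imp : Formula → Formula → Formula
  | pimp : Formula → Formula → Formula

namespace Formula

/-- `A ∧ B`, defined as `A + (A ⇒ B)`. -/
def conj (A B : Formula) : Formula := add A (pimp A B)

/-- `A ∨ B`, defined as `(B ⇒ A) → A`. -/
def disj (A B : Formula) : Formula := imp (pimp B A) A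

/-- The value of a formula in an abelian l-group under an assignment of the variables:
`t` is `0`, `A → B` is `-A + B`, and `A ⇒ B` is `(A → B) ∧ t`. -/
def eval {G : Type u} [AddCommGroup G] [Lattice G] (v : ℕ → G) : Formula → G
  | var n => v n
  | t => 0
  | neg A => -eval v A
  | add A B => eval v A + eval v B
  | imp A B => -eval v A + eval v B
  | pimp A B => (-eval v A + eval v B) ⊓ 0

theorem eval_conj {G : Type u} [AddCommGroup G] [Lattice G] [IsOrderedAddMonoid G]
    (v : ℕ → G) (A B : Formula) : (conj A B).eval v = A.eval v ⊓ B.eval v := by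
  simp [conj, eval, add_inf, inf_comm]

theorem eval_disj {G : Type u} [AddCommGroup G] [Lattice G] [IsOrderedAddMonoid G]
    (v : ℕ → G) (A B : Formula) : (disj A B).eval v = A.eval v ⊔ B.eval v := by
  simp [disj, eval, neg_inf, sup_add, sup_comm]

/-- Validity in all abelian l-groups: the value is at least `t` under every valuation. -/
def Valid (A : Formula) : Prop :=
  ∀ (G : Type u) [AddCommGroup G] [Lattice G] [IsOrderedAddMonoid G] (v : ℕ → G),
    0 ≤ A.eval v

/-- `A₁ + … + Aₖ`, which is `t` if `k = 0`. -/
def sum : List Formula → Formula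
  | [] => t
  | [A] => A
  | A :: B :: l => add A (sum (B :: l))

end Formula

/-- A sequent `Γ ⊢ Δ`: an ordered pair of finite multisets of formulas. -/
structure Sequent : Type where
  left : Multiset Formula
  right : Multiset Formula

/-- The sequent `Γ ⊢ Δ`. -/
infix:45 " ⊢ₛ " => Sequent.mk

namespace Sequent

/-- The interpretation `(A₁ + … + Aₙ) → (B₁ + … + Bₘ)` of `A₁, …, Aₙ ⊢ B₁, …, Bₘ`, for some
enumeration of the two multisets (its value does not depend on which). -/
noncomputable def interp (S : Sequent) : Formula :=
  Formula.imp (Formula.sum S.left.toList) (Formula.sum S.right.toList)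

/-- A sequent is valid in abelian logic iff its interpretation is. -/
def Valid (S : Sequent) : Prop := Formula.Valid.{u} S.interp

end Sequent

/-- `GAs S`: the sequent `S` is provable in the calculus `GA_s`. -/
inductive GAs : Sequent → Prop
  | id (A : Formula) : GAs ({A} ⊢ₛ {A})
  | empty : GAs (0 ⊢ₛ 0)
  | contraction (n : ℕ) (hn : 0 < n) (Γ Δ : Multiset Formula) :
      GAs (n • Γ ⊢ₛ n • Δ) → GAs (Γ ⊢ₛ Δ)
  | weakening (Γ Δ : Multiset Formula) (A B : Formula) :
      GAs (Γ ⊢ₛ Δ) → GAs (A.pimp B ::ₘ Γ ⊢ₛ Δ)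
  | mix (Γ₁ Γ₂ Δ₁ Δ₂ : Multiset Formula) :
      GAs (Γ₁ ⊢ₛ Δ₁) → GAs (Γ₂ ⊢ₛ Δ₂) → GAs (Γ₁ + Γ₂ ⊢ₛ Δ₁ + Δ₂)
  | t_left (Γ Δ : Multiset Formula) :
      GAs (Γ ⊢ₛ Δ) → GAs (Formula.t ::ₘ Γ ⊢ₛ Δ)
  | t_right (Γ Δ : Multiset Formula) :
      GAs (Γ ⊢ₛ Δ) → GAs (Γ ⊢ₛ Formula.t ::ₘ Δ)
  | neg_left (Γ Δ : Multiset Formula) (A : Formula) :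
      GAs (Γ ⊢ₛ A ::ₘ Δ) → GAs (A.neg ::ₘ Γ ⊢ₛ Δ)
  | neg_right (Γ Δ : Multiset Formula) (A : Formula) :
      GAs (A ::ₘ Γ ⊢ₛ Δ) → GAs (Γ ⊢ₛ A.neg ::ₘ Δ)
  | imp_left (Γ Δ : Multiset Formula) (A B : Formula) :
      GAs (B ::ₘ Γ ⊢ₛ A ::ₘ Δ) → GAs (A.imp B ::ₘ Γ ⊢ₛ Δ)
  | imp_right (Γ Δ : Multiset Formula) (A B : Formula) :
      GAs (A ::ₘ Γ ⊢ₛ B ::ₘ Δ) → GAs (Γ ⊢ₛ A.imp B ::ₘ Δ)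
  | add_left (Γ Δ : Multiset Formula) (A B : Formula) :
      GAs (A ::ₘ B ::ₘ Γ ⊢ₛ Δ) → GAs (A.add B ::ₘ Γ ⊢ₛ Δ)
  | add_right (Γ Δ : Multiset Formula) (A B : Formula) :
      GAs (Γ ⊢ₛ A ::ₘ B ::ₘ Δ) → GAs (Γ ⊢ₛ A.add B ::ₘ Δ)
  | pimp_left (Γ Δ : Multiset Formula) (A B : Formula) :
      GAs (B ::ₘ B.pimp A ::ₘ Γ ⊢ₛ A ::ₘ Δ) → GAs (A.pimp B ::ₘ Γ ⊢ₛ Δ)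
  | pimp_right (Γ Δ : Multiset Formula) (A B : Formula) :
      GAs (Γ ⊢ₛ Δ) → GAs (A ::ₘ Γ ⊢ₛ B ::ₘ Δ) → GAs (Γ ⊢ₛ A.pimp B ::ₘ Δ)

end AbelianLogic

/-!
For completeness, let `S` be unprovable. Replacing formulas by their parts, we may assume that `S`
consists of variables and, on the left, of formulas `A ⇒ B`, and that no variable occurs on both
sides. By Zorn's lemma there is a maximal set `C` of side sequents, containing the provable ones
that `S` absorbs, such that no positive multiple of `S` becomes provable by mixing in members of
`C`. Maximality makes `y ⊢ x ∈ C` a total translation-invariant preorder `x ≤ y` on the multisets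
`x` with `x ⊢ x ∈ C`, hence an order-reflecting map to a linearly ordered abelian group. In this
group `A ⇒ B` is interpreted correctly, because the case distinction between `A ⇒ B ⊢` and
`B ⇒ A ⊢` is admissible, and `S` has a negative value if all its variables belong to the domain of
the preorder. A variable outside the domain occurs in no formula of the domain, so that it can be
given any value while all others vanish; then only its own occurrences contribute to the value of
`S`.
-/

namespace AbelianLogic

section OrderedGroups

universe v

theorem nonneg_of_nsmul_nonneg {G : Type*} [AddCommGroup G] [Lattice G]
    [IsOrderedAddMonoid G] {n : ℕ} (hn : 0 < n) {a : G} (h : 0 ≤ n • a) : 0 ≤ a := by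
  have hne : (Finset.range n).Nonempty := Finset.nonempty_range_iff.2 hn.ne'
  set m := (Finset.range n).inf' hne (fun i => i • a)
  have m_le : ∀ i < n, m ≤ i • a := fun i hi => Finset.inf'_le _ (Finset.mem_range.2 hi)
  have sub_le : m - a ≤ m := by
    refine Finset.le_inf' hne _ fun i hi => ?_
    rw [sub_le_iff_le_add, ← succ_nsmul]
    rcases eq_or_ne (i + 1) n with rfl | hlt
    · exact (m_le 0 hn).trans (by rwa [zero_nsmul])
    · exact m_le _ (by grind)
  simpa using sub_le

theorem exists_linearOrder_of_total {G : Type v} [AddCommGroup G] (P : AddSubmonoid G)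
    (total : ∀ x, x ∈ P ∨ -x ∈ P) :
    ∃ (H : Type v) (_ : AddCommGroup H) (_ : LinearOrder H) (_ : IsOrderedAddMonoid H)
      (φ : G →+ H), ∀ x, 0 ≤ φ x ↔ x ∈ P := by
  classical
  let K : AddSubgroup G :=
    { P ⊓ P.comap negAddMonoidHom with
      neg_mem' := fun {a} ha => ⟨ha.2, by simpa using ha.1⟩ }
  let π := QuotientAddGroup.mk' K
  have mem_map : ∀ x, π x ∈ P.map π ↔ x ∈ P := by
    refine fun x => ⟨?_, fun h => ⟨x, h, rfl⟩⟩
    rintro ⟨y, hy, hxy⟩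
    have hK : -y + x ∈ K := QuotientAddGroup.eq.1 hxy
    simpa using P.add_mem hy hK.1
  let C : AddGroupCone (G ⧸ K) :=
    { P.map π with
      eq_zero_of_mem_of_neg_mem' := by
        intro a ha hna
        obtain ⟨x, rfl⟩ := QuotientAddGroup.mk'_surjective K a
        exact (QuotientAddGroup.eq_zero_iff x).2 ⟨(mem_map x).1 ha, (mem_map (-x)).1 hna⟩ }
  have : HasMemOrNegMem C := ⟨fun a => by
    obtain ⟨x, rfl⟩ := QuotientAddGroup.mk'_surjective K a
    exact (total x).imp (mem_map x).2 (mem_map (-x)).2⟩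
  refine ⟨G ⧸ K, inferInstance, LinearOrder.mkOfAddGroupCone C, IsOrderedAddMonoid.mkOfCone C, π,
    fun x => ?_⟩
  change π x - 0 ∈ P.map π ↔ _
  rw [sub_zero, mem_map]

theorem exists_linearOrder_of_total_rel {M : Type v} [AddCommMonoid M]
    (P : AddSubmonoid (M × M)) (total : ∀ x y, (x, y) ∈ P ∨ (y, x) ∈ P)
    (cancel : ∀ x y z, (x + z, y + z) ∈ P → (x, y) ∈ P) :
    ∃ (G : Type v) (_ : AddCommGroup G) (_ : LinearOrder G) (_ : IsOrderedAddMonoid G)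
      (φ : M →+ G), ∀ x y, φ x ≤ φ y ↔ (x, y) ∈ P := by
  let ι : M →+ Algebra.GrothendieckAddGroup M := Algebra.GrothendieckAddGroup.of
  let δ : M × M →+ Algebra.GrothendieckAddGroup M :=
    ι.comp (AddMonoidHom.snd M M) - ι.comp (AddMonoidHom.fst M M)
  have mem_map : ∀ p, δ p ∈ P.map δ ↔ p ∈ P := by
    refine fun p => ⟨?_, fun h => ⟨p, h, rfl⟩⟩
    rintro ⟨q, hq, hqp⟩
    have ι_eq : ι (q.2 + p.1) = ι (p.2 + q.1) := by
      rw [map_add, map_add]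
      exact sub_eq_sub_iff_add_eq_add.1 hqp
    obtain ⟨c, hc⟩ := (AddLocalization.addMonoidOf ⊤).exists_of_eq ι_eq
    have refl_mem : (p.1 + c, p.1 + c) ∈ P := (total _ _).elim id id
    refine cancel p.1 p.2 (q.1 + c) ?_
    convert P.add_mem hq refl_mem using 1
    refine Prod.ext ?_ ?_
    · simp only [Prod.fst_add]
      abel
    · calc p.2 + (q.1 + c) = c + (p.2 + q.1) := by abel
        _ = q.2 + (p.1 + c) := by rw [← hc]; abel
  have δ_surjective : ∀ g, ∃ x y, δ (x, y) = g := fun g => by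
    obtain ⟨⟨y, x⟩, hg⟩ := (AddLocalization.addMonoidOf ⊤).surj g
    exact ⟨x, y, (eq_sub_of_add_eq hg).symm⟩
  obtain ⟨G, _, _, _, φ, hφ⟩ := exists_linearOrder_of_total (P.map δ) fun g => by
    obtain ⟨x, y, rfl⟩ := δ_surjective g
    have neg_δ : -δ (x, y) = δ (y, x) := neg_sub (ι y) (ι x)
    rw [neg_δ, mem_map, mem_map]
    exact total x y
  refine ⟨G, _, ‹_›, ‹_›, φ.comp ι, fun x y => ?_⟩
  have map_δ : φ (δ (x, y)) = φ (ι y) - φ (ι x) := map_sub φ _ _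
  rw [← mem_map, ← hφ, map_δ, sub_nonneg]
  rfl

end OrderedGroups

attribute [ext] Sequent

namespace Sequent

instance : AddCommMonoid Sequent where
  zero := 0 ⊢ₛ 0
  add S T := S.left + T.left ⊢ₛ S.right + T.right
  nsmul n S := n • S.left ⊢ₛ n • S.right
  add_assoc _ _ _ := Sequent.ext (add_assoc _ _ _) (add_assoc _ _ _)
  zero_add _ := Sequent.ext (zero_add _) (zero_add _)
  add_zero _ := Sequent.ext (add_zero _) (add_zero _)
  add_comm _ _ := Sequent.ext (add_comm _ _) (add_comm _ _)
  nsmul_zero _ := Sequent.ext (zero_nsmul _) (zero_nsmul _)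
  nsmul_succ _ _ := Sequent.ext (succ_nsmul _ _) (succ_nsmul _ _)

/-- The sequent `A ⊢`. -/
def onLeft (A : Formula) : Sequent := {A} ⊢ₛ 0

/-- The sequent `⊢ A`. -/
def onRight (A : Formula) : Sequent := 0 ⊢ₛ {A}

theorem mk_cons_left (A : Formula) (Γ Δ : Multiset Formula) :
    (A ::ₘ Γ ⊢ₛ Δ) = (Γ ⊢ₛ Δ) + onLeft A :=
  Sequent.ext (by rw [← Multiset.singleton_add]; exact add_comm _ _) (add_zero Δ).symm

theorem mk_cons_right (A : Formula) (Γ Δ : Multiset Formula) :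
    (Γ ⊢ₛ A ::ₘ Δ) = (Γ ⊢ₛ Δ) + onRight A :=
  Sequent.ext (add_zero Γ).symm (by rw [← Multiset.singleton_add]; exact add_comm _ _)

theorem onLeft_add_onRight (A : Formula) : onLeft A + onRight A = ({A} ⊢ₛ {A}) :=
  Sequent.ext (add_zero _) (zero_add _)

theorem mk_add_mk_swap (Γ Δ : Multiset Formula) :
    (Γ ⊢ₛ Δ) + (Δ ⊢ₛ Γ) = (Γ + Δ ⊢ₛ Γ + Δ) :=
  Sequent.ext rfl (add_comm _ _)

theorem mem_of_forall_onLeft_onRight {N : AddSubmonoid Sequent} {S : Sequent}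
    (left : ∀ A ∈ S.left, onLeft A ∈ N) (right : ∀ A ∈ S.right, onRight A ∈ N) : S ∈ N := by
  obtain ⟨Γ, Δ⟩ := S
  induction Γ using Multiset.induction_on with
  | empty =>
    induction Δ using Multiset.induction_on with
    | empty => exact N.zero_mem
    | cons A Δ ih =>
      rw [mk_cons_right]
      exact N.add_mem (ih left fun B hB => right B (Multiset.mem_cons_of_mem hB))
        (right A (Multiset.mem_cons_self A Δ))
  | cons A Γ ih =>
    rw [mk_cons_left]
    exact N.add_mem (ih (fun B hB => left B (Multiset.mem_cons_of_mem hB)) right)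
      (left A (Multiset.mem_cons_self A Γ))

section Value

variable {G : Type*} [AddCommGroup G]

/-- The value `f B₁ + … + f Bₘ - (f A₁ + … + f Aₙ)` of `A₁, …, Aₙ ⊢ B₁, …, Bₘ` under an
assignment `f` of group elements to formulas. -/
def value (f : Formula → G) : Sequent →+ G where
  toFun S := (S.right.map f).sum - (S.left.map f).sum
  map_zero' := sub_self _
  map_add' S T := by
    change ((S.right + T.right).map f).sum - ((S.left + T.left).map f).sum = _
    simp only [Multiset.map_add, Multiset.sum_add]
    abel

theorem value_apply (f : Formula → G) (S : Sequent) :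
    value f S = (S.right.map f).sum - (S.left.map f).sum :=
  rfl

theorem value_onLeft (f : Formula → G) (A : Formula) : value f (onLeft A) = -f A := by
  simp [onLeft, value_apply]

theorem value_onRight (f : Formula → G) (A : Formula) : value f (onRight A) = f A := by
  simp [onRight, value_apply]

end Value

end Sequent

namespace Formula

variable {G : Type*} [AddCommGroup G] [Lattice G]

theorem eval_sum (v : ℕ → G) : ∀ l : List Formula, (sum l).eval v = (l.map (eval v)).sum
  | [] => rfl
  | [A] => by simp [sum]
  | A :: B :: l => by rw [List.map_cons, List.sum_cons, ← eval_sum v (B :: l)]; rfl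

theorem eval_map {H : Type*} [AddCommGroup H] [Lattice H] (φ : G →+ H)
    (map_inf : ∀ x y, φ (x ⊓ y) = φ x ⊓ φ y) (v : ℕ → G) (A : Formula) :
    A.eval (φ ∘ v) = φ (A.eval v) := by
  induction A with
  | var n => rfl
  | t => exact φ.map_zero.symm
  | neg A ihA => rw [eval, eval, ihA, map_neg]
  | add A B ihA ihB => rw [eval, eval, ihA, ihB, map_add]
  | imp A B ihA ihB => rw [eval, eval, ihA, ihB, map_add, map_neg]
  | pimp A B ihA ihB => rw [eval, eval, ihA, ihB, map_inf, map_add, map_neg, map_zero]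

end Formula

namespace Sequent

theorem eval_interp {G : Type*} [AddCommGroup G] [Lattice G] (v : ℕ → G) (S : Sequent) :
    S.interp.eval v = value (Formula.eval v) S := by
  have sum_toList (Γ : Multiset Formula) :
      (Formula.sum Γ.toList).eval v = (Γ.map (Formula.eval v)).sum := by
    rw [Formula.eval_sum, ← Multiset.sum_coe, ← Multiset.map_coe, Multiset.coe_toList]
  rw [interp, Formula.eval, sum_toList, sum_toList]
  exact neg_add_eq_sub _ _

end Sequent

theorem GAs.value_nonneg {S : Sequent} (h : GAs S) {G : Type*} [AddCommGroup G] [Lattice G]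
    [IsOrderedAddMonoid G] (v : ℕ → G) : 0 ≤ S.value (Formula.eval v) := by
  induction h with
  | id A => simp [Sequent.value_apply]
  | empty => simp [Sequent.value_apply]
  | contraction n hn Γ Δ _ ih =>
    refine nonneg_of_nsmul_nonneg hn ?_
    rw [← map_nsmul]
    exact ih
  | mix Γ₁ Γ₂ Δ₁ Δ₂ _ _ ih₁ ih₂ =>
    exact (add_nonneg ih₁ ih₂).trans_eq (map_add (Sequent.value _) (Γ₁ ⊢ₛ Δ₁) (Γ₂ ⊢ₛ Δ₂)).symm
  | weakening Γ Δ A B _ ih =>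
    have pimp_nonpos : (A.pimp B).eval v ≤ 0 := inf_le_right
    rw [Sequent.mk_cons_left, map_add, Sequent.value_onLeft]
    exact add_nonneg ih (neg_nonneg.2 pimp_nonpos)
  | pimp_left Γ Δ A B _ ih =>
    have eval_pimp : (A.pimp B).eval v = -A.eval v + B.eval v + (B.pimp A).eval v := by
      rw [Formula.eval, Formula.eval, add_inf, inf_comm]
      congr 1 <;> abel
    simp only [Sequent.mk_cons_left, Sequent.mk_cons_right, map_add, Sequent.value_onLeft,
      Sequent.value_onRight, eval_pimp] at ih ⊢
    exact ih.trans_eq (by abel)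
  | pimp_right Γ Δ A B _ _ ih₁ ih₂ =>
    simp only [Sequent.mk_cons_left, Sequent.mk_cons_right, map_add, Sequent.value_onLeft,
      Sequent.value_onRight] at ih₁ ih₂ ⊢
    rw [Formula.eval, add_inf]
    exact le_inf (ih₂.trans_eq (by abel)) (ih₁.trans_eq (by abel))
  | _ =>
    rename_i ih
    simp only [Sequent.mk_cons_left, Sequent.mk_cons_right, map_add, Sequent.value_onLeft,
      Sequent.value_onRight, Formula.eval] at ih ⊢
    exact ih.trans_eq (by abel)

theorem GAs.valid {S : Sequent} (h : GAs S) : Sequent.Valid.{u} S := fun _ _ _ _ v =>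
  (h.value_nonneg v).trans_eq (S.eval_interp v).symm

namespace Sequent

/-- `S` is refutable if it takes a negative value under some valuation in a linearly ordered abelian
group. The group is required to live in `Type 0`. -/
def Refutable (S : Sequent) : Prop :=
  ∃ (G : Type) (_ : AddCommGroup G) (_ : LinearOrder G) (_ : IsOrderedAddMonoid G) (v : ℕ → G),
    S.value (Formula.eval v) < 0

theorem Refutable.not_valid {S : Sequent} : S.Refutable → ¬ Valid.{u} S := by
  rintro ⟨G, _, _, _, v, hv⟩ valid
  have : IsOrderedAddMonoid (ULift.{u} G) :=
    Function.Injective.isOrderedAddMonoid ULift.down (fun _ _ => rfl) Iff.rfl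
  let down : ULift.{u} G →+ G := AddEquiv.ulift.toAddMonoidHom
  have eval_interp_nonneg : 0 ≤ S.interp.eval v :=
    (ULift.down_le.2 (valid (ULift.{u} G) (ULift.up ∘ v))).trans_eq
      (S.interp.eval_map down (fun _ _ => rfl) (ULift.up ∘ v)).symm
  rw [S.eval_interp v] at eval_interp_nonneg
  exact hv.not_ge eval_interp_nonneg

end Sequent

open Sequent

namespace GAs

theorem add {S T : Sequent} (hS : GAs S) (hT : GAs T) : GAs (S + T) :=
  mix _ _ _ _ hS hT

theorem of_nsmul {S : Sequent} {n : ℕ} (hn : 0 < n) (h : GAs (n • S)) : GAs S :=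
  contraction n hn _ _ h

theorem nsmul {S : Sequent} (h : GAs S) : ∀ n : ℕ, GAs (n • S)
  | 0 => by
    rw [zero_nsmul]
    exact empty
  | n + 1 => by
    rw [succ_nsmul]
    exact (h.nsmul n).add h

theorem refl (Γ : Multiset Formula) : GAs (Γ ⊢ₛ Γ) := by
  induction Γ using Multiset.induction_on with
  | empty => exact empty
  | cons A Γ ih =>
    rw [← Multiset.singleton_add]
    exact (id A).add ih

theorem pimp_nonpos (A B : Formula) : GAs (onLeft (A.pimp B)) :=
  weakening 0 0 A B empty

end GAs

namespace Sequent

/-- `T` is derivable from `S` in every context. -/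
def Derives (S T : Sequent) : Prop :=
  ∀ U, GAs (U + S) → GAs (U + T)

namespace Derives

variable {S T U S' T' : Sequent} {A B : Formula}

theorem refl (S : Sequent) : S.Derives S := fun _ h => h

theorem trans (h : S.Derives T) (h' : T.Derives U) : S.Derives U := fun V hV => h' V (h V hV)

instance : Trans Derives Derives Derives := ⟨trans⟩

theorem add (h : S.Derives T) (h' : S'.Derives T') : (S + S').Derives (T + T') := by
  intro U hU
  rw [← add_assoc] at hU ⊢
  have hT := h' _ hU
  rw [add_right_comm] at hT ⊢
  exact h _ hT

theorem nsmul (h : S.Derives T) : ∀ n : ℕ, (n • S).Derives (n • T)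
  | 0 => by
    rw [zero_nsmul, zero_nsmul]
    exact refl 0
  | n + 1 => by
    rw [succ_nsmul, succ_nsmul]
    exact (h.nsmul n).add h

theorem of_GAs (h : GAs T) : Derives 0 T := fun U hU => by
  rw [add_zero] at hU
  exact hU.add h

theorem add_of_GAs (S : Sequent) (h : GAs T) : S.Derives (S + T) := by
  simpa only [add_zero] using (refl S).add (of_GAs h)

theorem neg_left : (onRight A).Derives (onLeft A.neg) := by
  rintro ⟨Γ, Δ⟩ h
  simp only [← mk_cons_left, ← mk_cons_right] at h ⊢
  exact .neg_left _ _ _ h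

theorem neg_right : (onLeft A).Derives (onRight A.neg) := by
  rintro ⟨Γ, Δ⟩ h
  simp only [← mk_cons_left, ← mk_cons_right] at h ⊢
  exact .neg_right _ _ _ h

theorem add_left : (onLeft B + onLeft A).Derives (onLeft (A.add B)) := by
  rintro ⟨Γ, Δ⟩ h
  simp only [← add_assoc, ← mk_cons_left] at h ⊢
  exact .add_left _ _ _ _ h

theorem add_right : (onRight B + onRight A).Derives (onRight (A.add B)) := by
  rintro ⟨Γ, Δ⟩ h
  simp only [← add_assoc, ← mk_cons_right] at h ⊢
  exact .add_right _ _ _ _ h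

theorem imp_left : (onLeft B + onRight A).Derives (onLeft (A.imp B)) := by
  rintro ⟨Γ, Δ⟩ h
  simp only [← add_assoc, ← mk_cons_left, ← mk_cons_right] at h ⊢
  exact .imp_left _ _ _ _ h

theorem imp_right : (onLeft A + onRight B).Derives (onRight (A.imp B)) := by
  rintro ⟨Γ, Δ⟩ h
  simp only [← add_assoc, ← mk_cons_left, ← mk_cons_right] at h ⊢
  exact .imp_right _ _ _ _ h

theorem pimp_left :
    (onLeft (B.pimp A) + onLeft B + onRight A).Derives (onLeft (A.pimp B)) := by
  rintro ⟨Γ, Δ⟩ h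
  simp only [← add_assoc, ← mk_cons_left, ← mk_cons_right] at h ⊢
  exact .pimp_left _ _ _ _ h

theorem pimp_left_of_imp : (onLeft B + onRight A).Derives (onLeft (A.pimp B)) :=
  calc (onLeft B + onRight A).Derives (onLeft B + onRight A + onLeft (B.pimp A)) :=
        add_of_GAs _ (GAs.pimp_nonpos B A)
    _ = onLeft (B.pimp A) + onLeft B + onRight A := by abel
    Derives _ (onLeft (A.pimp B)) := pimp_left

theorem pimp_left_cancel (A B : Formula) :
    (onLeft (A.pimp B) + (({A} ⊢ₛ {A}) + ({B} ⊢ₛ {B}))).Derives (onLeft (A.pimp B)) :=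
  calc onLeft (A.pimp B) + (({A} ⊢ₛ {A}) + ({B} ⊢ₛ {B}))
    _ = onLeft (A.pimp B) + onLeft A + onRight B + (onLeft B + onRight A) := by
        rw [← onLeft_add_onRight, ← onLeft_add_onRight]
        abel
    Derives _ (onLeft (B.pimp A) + (onLeft B + onRight A)) := pimp_left.add (refl _)
    _ = onLeft (B.pimp A) + onLeft B + onRight A := by abel
    Derives _ (onLeft (A.pimp B)) := pimp_left

theorem pimp_swap (A B : Formula) :
    (onLeft (B.pimp A)).Derives (onLeft (A.pimp B) + (onLeft A + onRight B)) :=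
  calc (onLeft (B.pimp A)).Derives (onLeft (B.pimp A) + (({A} ⊢ₛ {A}) + ({B} ⊢ₛ {B}))) :=
        add_of_GAs _ ((GAs.id A).add (GAs.id B))
    _ = onLeft (B.pimp A) + onLeft B + onRight A + (onLeft A + onRight B) := by
        rw [← onLeft_add_onRight, ← onLeft_add_onRight]
        abel
    Derives _ (onLeft (A.pimp B) + (onLeft A + onRight B)) := pimp_left.add (refl _)

theorem id_neg (A : Formula) : Derives ({A} ⊢ₛ {A}) ({A.neg} ⊢ₛ {A.neg}) := by
  rw [← onLeft_add_onRight, ← onLeft_add_onRight, add_comm]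
  exact neg_left.add neg_right

theorem id_add (A B : Formula) :
    Derives (({A} ⊢ₛ {A}) + ({B} ⊢ₛ {B})) ({A.add B} ⊢ₛ {A.add B}) := by
  simp only [← onLeft_add_onRight]
  calc onLeft A + onRight A + (onLeft B + onRight B)
    _ = onLeft B + onLeft A + (onRight B + onRight A) := by abel
    Derives _ (onLeft (A.add B) + onRight (A.add B)) := add_left.add add_right

theorem id_imp (A B : Formula) :
    Derives (({A} ⊢ₛ {A}) + ({B} ⊢ₛ {B})) ({A.imp B} ⊢ₛ {A.imp B}) := by
  simp only [← onLeft_add_onRight]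
  calc onLeft A + onRight A + (onLeft B + onRight B)
    _ = onLeft B + onRight A + (onLeft A + onRight B) := by abel
    Derives _ (onLeft (A.imp B) + onRight (A.imp B)) := imp_left.add imp_right

theorem id_pimp (A B : Formula) :
    Derives (({A} ⊢ₛ {A}) + ({B} ⊢ₛ {B})) ({A.pimp B} ⊢ₛ {A.pimp B}) := by
  set I := ({A} ⊢ₛ {A}) + ({B} ⊢ₛ {B})
  calc I.Derives (I + ({A.pimp B} ⊢ₛ {A.pimp B})) := add_of_GAs I (.id _)
    _ = onLeft (A.pimp B) + I + onRight (A.pimp B) := by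
        rw [← onLeft_add_onRight]
        abel
    Derives _ (onLeft (A.pimp B) + onRight (A.pimp B)) := (pimp_left_cancel A B).add (refl _)
    _ = ({A.pimp B} ⊢ₛ {A.pimp B}) := onLeft_add_onRight _

end Derives

end Sequent

namespace GAs

variable {S : Sequent} {A B : Formula}

theorem pimp_detach (A B : Formula) :
    GAs (onLeft (A.pimp B) + (onLeft A + onRight B)) := by
  have ids : GAs (({A} ⊢ₛ {A}) + ({B} ⊢ₛ {B})) := (id A).add (id B)
  have detached := Derives.pimp_left_of_imp (A := A) (B := B) (onLeft A + onRight B) (by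
    convert ids using 1
    rw [← onLeft_add_onRight, ← onLeft_add_onRight]
    abel)
  rwa [add_comm] at detached

theorem pimp_right_nsmul (n : ℕ) (h : ∀ i ≤ n, GAs (S + i • (onLeft A + onRight B))) :
    GAs (S + n • onRight (A.pimp B)) := by
  induction n generalizing S with
  | zero => simpa using h 0 le_rfl
  | succ n ih =>
    have without : GAs (S + n • onRight (A.pimp B)) := ih fun i hi => h i (by lia)
    have with_AB : GAs (S + (onLeft A + onRight B) + n • onRight (A.pimp B)) :=
      ih fun i hi => by
        convert h (i + 1) (by lia) using 1
        module
    rw [add_right_comm, ← add_assoc, ← mk_cons_left, ← mk_cons_right] at with_AB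
    rw [succ_nsmul, ← add_assoc, ← mk_cons_right]
    exact pimp_right _ _ _ _ without with_AB

-- By `pimp_right_nsmul`, it is enough to prove `S` with `2 * M` copies of `A ⇒ B ⊢` and `i` copies
-- of `A ⊢ B`, for each `i ≤ 2 * M`. If `i ≤ M`, this comes from `h₁`. If `i = M + j`, it comes from
-- `h₂`, since `Derives.pimp_swap` turns each `B ⇒ A ⊢` into `A ⇒ B ⊢` together with `A ⊢ B`.
theorem case_split_pimp (M : ℕ) (h₁ : GAs (S + M • onLeft (A.pimp B)))
    (h₂ : GAs (S + M • onLeft (B.pimp A))) :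
    GAs (S + (2 * M) • ({A.pimp B} ⊢ₛ {A.pimp B})) := by
  have with_copies : ∀ i ≤ 2 * M,
      GAs (S + (2 * M) • onLeft (A.pimp B) + i • (onLeft A + onRight B)) := by
    intro i hi
    have detach := fun n => (pimp_detach A B).nsmul n
    have weaken := fun n => (pimp_nonpos A B).nsmul n
    rcases le_total i M with hiM | hMi
    · obtain ⟨k, rfl⟩ := Nat.exists_eq_add_of_le hiM
      convert (h₁.add (detach i)).add (weaken k) using 1
      module
    · obtain ⟨j, rfl⟩ := Nat.exists_eq_add_of_le hMi
      obtain ⟨k, rfl⟩ := Nat.exists_eq_add_of_le (show j ≤ M by lia)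
      have swapped := (Derives.pimp_swap A B).nsmul (j + k) _ h₂
      convert (swapped.add (detach j)).add (weaken k) using 1
      module
  convert pimp_right_nsmul (2 * M) with_copies using 1
  rw [← onLeft_add_onRight]
  module

end GAs

namespace Sequent

section Modulo

variable {S T T₁ T₂ : Sequent} {K C C' : AddSubmonoid Sequent} {A B : Formula}

/-- Some positive multiple of `S` becomes provable after mixing in a side sequent from `C`. -/
def ProvableModulo (C : AddSubmonoid Sequent) (S : Sequent) : Prop :=
  ∃ n, 0 < n ∧ ∃ T ∈ C, GAs (n • S + T)

/-- The submonoid of provable sequents. -/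
def provable : AddSubmonoid Sequent where
  carrier := {T | GAs T}
  zero_mem' := GAs.empty
  add_mem' := GAs.add

/-- The provable side sequents which can be dropped in the presence of `S`. -/
def absorbed (S : Sequent) : AddSubmonoid Sequent where
  carrier := {T | GAs T ∧ (S + T).Derives S}
  zero_mem' := ⟨GAs.empty, by simpa only [add_zero] using Derives.refl S⟩
  add_mem' := by
    rintro T₁ T₂ ⟨hT₁, absorbs₁⟩ ⟨hT₂, absorbs₂⟩
    refine ⟨hT₁.add hT₂, .trans ?_ absorbs₂⟩
    rw [← add_assoc]
    exact absorbs₁.add (.refl T₂)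

theorem ProvableModulo.of_absorbed : ProvableModulo (absorbed S) S → GAs S := by
  rintro ⟨n, hn, T, ⟨-, absorbs⟩, h⟩
  obtain ⟨m, rfl⟩ := Nat.exists_eq_succ_of_ne_zero hn.ne'
  rw [succ_nsmul, add_assoc] at h
  refine .of_nsmul hn ?_
  rw [succ_nsmul]
  exact absorbs _ h

theorem exists_maximal_not_provableModulo (hCK : C ≤ K) (hC : ¬ ProvableModulo C S) :
    ∃ C', C ≤ C' ∧ Maximal (fun N => N ≤ K ∧ ¬ ProvableModulo N S) C' := by
  refine zorn_le_nonempty₀ {N | N ≤ K ∧ ¬ ProvableModulo N S} ?_ C ⟨hCK, hC⟩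
  refine fun c hc chain D hD => ⟨sSup c, ⟨sSup_le fun E hE => (hc hE).1, ?_⟩, fun E => le_sSup⟩
  rintro ⟨n, hn, T, hT, h⟩
  obtain ⟨E, hE, hTE⟩ := (AddSubmonoid.mem_sSup_of_directedOn ⟨D, hD⟩ chain.directedOn).1 hT
  exact (hc hE).2 ⟨n, hn, T, hTE, h⟩

section Maximal

variable (hC : Maximal (fun N => N ≤ K ∧ ¬ ProvableModulo N S) C)
include hC

theorem exists_GAs_of_notMem (hTK : T ∈ K) (hT : T ∉ C) :
    ∃ n, 0 < n ∧ ∃ U ∈ C, ∃ k : ℕ, GAs (n • S + U + k • T) := by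
  have not_le : ¬ C ⊔ AddSubmonoid.multiples T ≤ C := fun h =>
    hT (h (AddSubmonoid.mem_sup_right (AddSubmonoid.mem_multiples T)))
  have modulo_sup : ProvableModulo (C ⊔ AddSubmonoid.multiples T) S := by
    by_contra h
    exact not_le (hC.le_of_ge ⟨sup_le hC.prop.1 (AddSubmonoid.multiples_le.2 hTK), h⟩ le_sup_left)
  obtain ⟨n, hn, V, hV, h⟩ := modulo_sup
  obtain ⟨U, hU, W, ⟨k, rfl⟩, rfl⟩ := AddSubmonoid.mem_sup.1 hV
  exact ⟨n, hn, U, hU, k, by rwa [add_assoc]⟩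

theorem mem_of_derives_of_maximal (hT₁ : T₁ ∈ K) (h : T₁.Derives T₂) (hT₂ : T₂ ∈ C) :
    T₁ ∈ C := by
  by_contra hT
  obtain ⟨n, hn, U, hU, k, hk⟩ := exists_GAs_of_notMem hC hT₁ hT
  refine hC.prop.2 ⟨n, hn, U + k • T₂, C.add_mem hU (C.nsmul_mem hT₂ k), ?_⟩
  rw [← add_assoc]
  exact h.nsmul k _ hk

theorem mem_or_mem_of_maximal (hT₁ : T₁ ∈ K) (hT₂ : T₂ ∈ K) (h : T₁ + T₂ ∈ C) :
    T₁ ∈ C ∨ T₂ ∈ C := by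
  by_contra! hT
  obtain ⟨n, hn, U, hU, k, hk⟩ := exists_GAs_of_notMem hC hT₁ hT.1
  obtain ⟨m, hm, V, hV, l, hl⟩ := exists_GAs_of_notMem hC hT₂ hT.2
  rcases k.eq_zero_or_pos with rfl | hk₀
  · exact hC.prop.2 ⟨n, hn, U, hU, by simpa only [zero_nsmul, add_zero] using hk⟩
  · refine hC.prop.2 ⟨l * n + k * m, by positivity, l • U + k • V + (k * l) • (T₁ + T₂),
      C.add_mem (C.add_mem (C.nsmul_mem hU l) (C.nsmul_mem hV k)) (C.nsmul_mem h (k * l)), ?_⟩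
    convert (hk.nsmul l).add (hl.nsmul k) using 1
    module

end Maximal

theorem pimp_mem_or_mem_of_maximal
    (hC : Maximal (fun K => K ≤ provable ∧ ¬ ProvableModulo K S) C) (hCC' : C ≤ C')
    (hC' : ¬ ProvableModulo C' S) (hAB : ({A.pimp B} ⊢ₛ {A.pimp B}) ∈ C') :
    onLeft (A.pimp B) ∈ C ∨ onLeft (B.pimp A) ∈ C := by
  by_contra! hpimp
  obtain ⟨n, hn, U, hU, k, hk⟩ := exists_GAs_of_notMem hC (GAs.pimp_nonpos A B) hpimp.1
  obtain ⟨m, hm, V, hV, l, hl⟩ := exists_GAs_of_notMem hC (GAs.pimp_nonpos B A) hpimp.2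
  have provable_of_mem : ∀ {T}, T ∈ C → GAs T := fun hT => hC.prop.1 hT
  set W := m • U + n • V
  set N := m * k + n * l
  have hW : W ∈ C := C.add_mem (C.nsmul_mem hU m) (C.nsmul_mem hV n)
  have left_AB : GAs ((n * m) • S + W + N • onLeft (A.pimp B)) := by
    convert ((hk.nsmul m).add ((provable_of_mem hV).nsmul n)).add
      ((GAs.pimp_nonpos A B).nsmul (n * l)) using 1
    module
  have left_BA : GAs ((n * m) • S + W + N • onLeft (B.pimp A)) := by
    convert ((hl.nsmul n).add ((provable_of_mem hU).nsmul m)).add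
      ((GAs.pimp_nonpos B A).nsmul (m * k)) using 1
    module
  refine hC' ⟨n * m, by positivity, W + (2 * N) • ({A.pimp B} ⊢ₛ {A.pimp B}),
    C'.add_mem (hCC' hW) (C'.nsmul_mem hAB _), ?_⟩
  rw [← add_assoc]
  exact GAs.case_split_pimp N left_AB left_BA

/-- The properties of a set `C` of side sequents which make its members behave as the sequents of
nonpositive value in a linearly ordered group where `S` takes a negative value. -/
structure Saturated (S : Sequent) (C : AddSubmonoid Sequent) : Prop where
  absorbed_le : absorbed S ≤ C
  not_provableModulo : ¬ ProvableModulo C S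
  mem_of_derives : ∀ {T₁ T₂ : Sequent}, T₁.Derives T₂ → T₂ ∈ C → T₁ ∈ C
  mem_or_mem : ∀ {T₁ T₂ : Sequent}, T₁ + T₂ ∈ C → T₁ ∈ C ∨ T₂ ∈ C
  pimp_mem_or_mem : ∀ {A B : Formula}, ({A.pimp B} ⊢ₛ {A.pimp B}) ∈ C →
    onLeft (A.pimp B) ∈ C ∨ onLeft (B.pimp A) ∈ C

-- Zorn's lemma is applied twice: `pimp_mem_or_mem_of_maximal` needs provable side sequents, to give
-- both premises of `GAs.case_split_pimp` the same context, whereas `mem_or_mem_of_maximal` needs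
-- maximality among all submonoids.
theorem exists_saturated (hS : ¬ GAs S) : ∃ C, Saturated S C := by
  obtain ⟨C, absorbed_le_C, hC⟩ := exists_maximal_not_provableModulo (C := absorbed S)
    (K := provable) (fun _ hT => hT.1) (mt ProvableModulo.of_absorbed hS)
  obtain ⟨C', C_le_C', hC'⟩ := exists_maximal_not_provableModulo (K := ⊤) le_top hC.prop.2
  exact ⟨C', absorbed_le_C.trans C_le_C', hC'.prop.2,
    mem_of_derives_of_maximal hC' (AddSubmonoid.mem_top _),
    mem_or_mem_of_maximal hC' (AddSubmonoid.mem_top _) (AddSubmonoid.mem_top _),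
    fun h => (pimp_mem_or_mem_of_maximal hC C_le_C' hC'.prop.2 h).imp (C_le_C' ·) (C_le_C' ·)⟩

end Modulo

/-- The multisets whose identity sequent is a side sequent in `C`; on these, `C` induces a
translation-invariant preorder. -/
def domain (C : AddSubmonoid Sequent) : AddSubmonoid (Multiset Formula) where
  carrier := {Γ | (Γ ⊢ₛ Γ) ∈ C}
  zero_mem' := C.zero_mem
  add_mem' := C.add_mem

namespace Saturated

variable {S : Sequent} {C : AddSubmonoid Sequent} (hC : Saturated S C)
include hC

theorem mem_domain_of_add_mem {A B : Formula} (h : ({A} ⊢ₛ {A}) + ({B} ⊢ₛ {B}) ∈ C) :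
    {A} ∈ domain C ∧ {B} ∈ domain C := by
  refine ⟨hC.mem_of_derives (.add_of_GAs _ (.id B)) h, ?_⟩
  rw [add_comm] at h
  exact hC.mem_of_derives (.add_of_GAs _ (.id A)) h

theorem mem_domain_of_pimp_mem {A B : Formula} (h : A.pimp B ∈ S.left) :
    {A} ∈ domain C ∧ {B} ∈ domain C := by
  obtain ⟨Γ, hΓ⟩ := Multiset.exists_cons_of_mem h
  have hS : S = (Γ ⊢ₛ S.right) + onLeft (A.pimp B) := by
    rw [← mk_cons_left, ← hΓ]
  have absorbs : (S + (({A} ⊢ₛ {A}) + ({B} ⊢ₛ {B}))).Derives S := by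
    rw [hS, add_assoc]
    exact (Derives.refl _).add (Derives.pimp_left_cancel A B)
  exact hC.mem_domain_of_add_mem (hC.absorbed_le ⟨(GAs.id A).add (GAs.id B), absorbs⟩)

theorem exists_linearOrder : ∃ (G : Type) (_ : AddCommGroup G) (_ : LinearOrder G)
    (_ : IsOrderedAddMonoid G) (φ : domain C →+ G),
    ∀ x y : domain C, φ x ≤ φ y ↔ ((y : Multiset Formula) ⊢ₛ x) ∈ C := by
  let P : AddSubmonoid (domain C × domain C) :=
    { carrier := {p | ((p.2 : Multiset Formula) ⊢ₛ p.1) ∈ C}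
      zero_mem' := C.zero_mem
      add_mem' := C.add_mem }
  refine exists_linearOrder_of_total_rel P (fun x y => hC.mem_or_mem ?_) fun x y z hxyz => ?_
  · rw [mk_add_mk_swap]
    exact (y + x).2
  · exact hC.mem_of_derives (.add_of_GAs _ (.refl z)) hxyz

section Model

variable {G : Type*} [AddCommGroup G] [LinearOrder G]
  {φ : domain C →+ G} (hφ : ∀ x y : domain C, φ x ≤ φ y ↔ ((y : Multiset Formula) ⊢ₛ x) ∈ C)
include hφ

theorem map_le_map_of_GAs {x y : domain C} (h : GAs ((x : Multiset Formula) ⊢ₛ y)) :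
    φ x ≤ φ y := by
  refine (hφ x y).2 (hC.mem_of_derives (.add_of_GAs _ h) ?_)
  rw [mk_add_mk_swap]
  exact (y + x).2

theorem map_eq_map_of_GAs {x y : domain C} (h : GAs ((x : Multiset Formula) ⊢ₛ y))
    (h' : GAs ((y : Multiset Formula) ⊢ₛ x)) : φ x = φ y :=
  (hC.map_le_map_of_GAs hφ h).antisymm (hC.map_le_map_of_GAs hφ h')

theorem map_pimp [IsOrderedAddMonoid G] {A B : Formula} (hA : {A} ∈ domain C) (hB : {B} ∈ domain C)
    (hAB : {A.pimp B} ∈ domain C) :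
    φ ⟨_, hAB⟩ = (-φ ⟨_, hA⟩ + φ ⟨_, hB⟩) ⊓ 0 := by
  set a := φ ⟨_, hA⟩
  set b := φ ⟨_, hB⟩
  set p := φ ⟨_, hAB⟩
  have nonpos : p ≤ 0 :=
    (hC.map_le_map_of_GAs hφ (y := 0) (GAs.pimp_nonpos A B)).trans_eq (map_zero φ)
  have detach : p + a ≤ b := by
    rw [← map_add]
    exact hC.map_le_map_of_GAs hφ (GAs.pimp_detach A B)
  have le : p ≤ -a + b := by rwa [le_neg_add_iff_add_le, add_comm]
  rcases hC.pimp_mem_or_mem hAB with hp | hp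
  · have nonneg : 0 ≤ p := (map_zero φ).symm.trans_le ((hφ 0 ⟨_, hAB⟩).2 hp)
    exact (le_inf le nonpos).antisymm (inf_le_right.trans nonneg)
  · have ge : b ≤ p + a := by
      rw [← map_add, hφ]
      exact hC.mem_of_derives Derives.pimp_left hp
    exact (le_inf le nonpos).antisymm (inf_le_left.trans (by rwa [neg_add_le_iff_le_add, add_comm]))

open Classical in
/-- The valuation giving a variable in the domain its value under `φ`, and the others the value
`0`. -/
noncomputable def valuation (φ : domain C →+ G) (n : ℕ) : G :=
  if h : {Formula.var n} ∈ domain C then φ ⟨_, h⟩ else 0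

theorem eval_valuation [IsOrderedAddMonoid G] (A : Formula) (hA : {A} ∈ domain C) :
    A.eval (valuation φ) = φ ⟨_, hA⟩ := by
  induction A with
  | var n => exact dif_pos hA
  | t =>
    refine (map_zero φ).symm.trans (hC.map_eq_map_of_GAs hφ ?_ ?_)
    · exact GAs.t_right 0 0 GAs.empty
    · exact GAs.t_left 0 0 GAs.empty
  | neg A ihA =>
    have hA' : {A} ∈ domain C := hC.mem_of_derives (.id_neg A) hA
    rw [Formula.eval, ihA hA', neg_eq_iff_add_eq_zero, add_comm, ← map_add, ← map_zero φ]
    exact hC.map_eq_map_of_GAs hφ (GAs.neg_left {A} 0 A (GAs.id A))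
      (GAs.neg_right 0 {A} A (GAs.id A))
  | add A B ihA ihB =>
    obtain ⟨hA', hB'⟩ := hC.mem_domain_of_add_mem (hC.mem_of_derives (.id_add A B) hA)
    rw [Formula.eval, ihA hA', ihB hB', ← map_add]
    exact hC.map_eq_map_of_GAs hφ (GAs.add_right _ _ A B (GAs.refl {A, B}))
      (GAs.add_left _ _ A B (GAs.refl {A, B}))
  | imp A B ihA ihB =>
    obtain ⟨hA', hB'⟩ := hC.mem_domain_of_add_mem (hC.mem_of_derives (.id_imp A B) hA)
    rw [Formula.eval, ihA hA', ihB hB', neg_add_eq_iff_eq_add, add_comm, ← map_add]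
    have exchange (A B : Formula) : GAs ({A, B} ⊢ₛ {B, A}) := by
      rw [Multiset.pair_comm]
      exact GAs.refl _
    exact hC.map_eq_map_of_GAs hφ (GAs.imp_right {B} {A} A B (exchange A B))
      (GAs.imp_left {A} {B} A B (exchange B A))
  | pimp A B ihA ihB =>
    obtain ⟨hA', hB'⟩ := hC.mem_domain_of_add_mem (hC.mem_of_derives (.id_pimp A B) hA)
    rw [Formula.eval, ihA hA', ihB hB', hC.map_pimp hφ hA' hB']

/-- The sequents derivable from some `x ⊢ y` with `x` and `y` in the domain and of the same value as
that sequent, which is `φ y - φ x`. If `S` is one of them, the valuation refutes `S`. -/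
def linearized (φ : domain C →+ G) : AddSubmonoid Sequent where
  carrier := {T | ∃ x y : domain C, ((x : Multiset Formula) ⊢ₛ y).Derives T ∧
    T.value (Formula.eval (valuation φ)) = φ y - φ x}
  zero_mem' := ⟨0, 0, .refl 0, by simp⟩
  add_mem' := by
    rintro T T' ⟨x, y, hT, value_T⟩ ⟨x', y', hT', value_T'⟩
    refine ⟨x + x', y + y', hT.add hT', ?_⟩
    rw [map_add, map_add, map_add, value_T, value_T']
    abel

variable [IsOrderedAddMonoid G]

theorem onLeft_mem_linearized {A : Formula} (hA : {A} ∈ domain C) :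
    onLeft A ∈ linearized φ := by
  refine ⟨⟨_, hA⟩, 0, .refl _, ?_⟩
  rw [value_onLeft, hC.eval_valuation hφ A hA, map_zero, zero_sub]

theorem onRight_mem_linearized {A : Formula} (hA : {A} ∈ domain C) :
    onRight A ∈ linearized φ := by
  refine ⟨0, ⟨_, hA⟩, .refl _, ?_⟩
  rw [value_onRight, hC.eval_valuation hφ A hA, map_zero, sub_zero]

theorem onLeft_pimp_mem_linearized {A B : Formula} (hA : {A} ∈ domain C) (hB : {B} ∈ domain C) :
    onLeft (A.pimp B) ∈ linearized φ := by
  rcases le_total (φ ⟨_, hA⟩) (φ ⟨_, hB⟩) with hle | hle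
  · refine ⟨0, 0, .of_GAs (GAs.pimp_nonpos A B), ?_⟩
    rw [value_onLeft, Formula.eval, hC.eval_valuation hφ A hA, hC.eval_valuation hφ B hB,
      inf_eq_right.2 (by rwa [le_neg_add_iff_add_le, add_zero])]
    simp
  · refine ⟨⟨_, hB⟩, ⟨_, hA⟩, Derives.pimp_left_of_imp, ?_⟩
    rw [value_onLeft, Formula.eval, hC.eval_valuation hφ A hA, hC.eval_valuation hφ B hB,
      inf_eq_left.2 (by rwa [neg_add_le_iff_le_add, add_zero])]
    abel

theorem value_neg_of_mem_linearized (hS : S ∈ linearized φ) :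
    S.value (Formula.eval (valuation φ)) < 0 := by
  obtain ⟨x, y, hxy, value_S⟩ := hS
  by_contra! nonneg
  rw [value_S, sub_nonneg, hφ] at nonneg
  refine hC.not_provableModulo ⟨1, one_pos, _, nonneg, ?_⟩
  rw [one_nsmul, add_comm]
  refine hxy _ ?_
  rw [mk_add_mk_swap]
  exact GAs.refl _

end Model

theorem refutable (left : ∀ A ∈ S.left, {A} ∈ domain C ∨ ∃ B D : Formula, A = B.pimp D)
    (right : ∀ A ∈ S.right, {A} ∈ domain C) : S.Refutable := by
  obtain ⟨G, _, _, _, φ, hφ⟩ := hC.exists_linearOrder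
  refine ⟨G, _, ‹_›, ‹_›, valuation φ, hC.value_neg_of_mem_linearized hφ
    (mem_of_forall_onLeft_onRight ?_ ?_)⟩
  · intro A hA
    rcases left A hA with hA' | ⟨B, D, rfl⟩
    · exact hC.onLeft_mem_linearized hφ hA'
    · obtain ⟨hB, hD⟩ := hC.mem_domain_of_pimp_mem hA
      exact hC.onLeft_pimp_mem_linearized hφ hB hD
  · exact fun A hA => hC.onRight_mem_linearized hφ (right A hA)

theorem eval_single_eq_zero_of_mem_domain {p : ℕ} (hp : {Formula.var p} ∉ domain C) (a : ℤ)
    {A : Formula} (hA : {A} ∈ domain C) : A.eval (Pi.single p a) = 0 := by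
  induction A with
  | var n =>
    have hn : n ≠ p := fun h => hp (h ▸ hA)
    exact Pi.single_eq_of_ne hn _
  | t => rfl
  | neg A ihA => rw [Formula.eval, ihA (hC.mem_of_derives (.id_neg A) hA), neg_zero]
  | add A B ihA ihB =>
    obtain ⟨hA', hB'⟩ := hC.mem_domain_of_add_mem (hC.mem_of_derives (.id_add A B) hA)
    rw [Formula.eval, ihA hA', ihB hB', add_zero]
  | imp A B ihA ihB =>
    obtain ⟨hA', hB'⟩ := hC.mem_domain_of_add_mem (hC.mem_of_derives (.id_imp A B) hA)
    rw [Formula.eval, ihA hA', ihB hB', neg_zero, add_zero]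
  | pimp A B ihA ihB =>
    obtain ⟨hA', hB'⟩ := hC.mem_domain_of_add_mem (hC.mem_of_derives (.id_pimp A B) hA)
    rw [Formula.eval, ihA hA', ihB hB', neg_zero, add_zero, inf_idem]

end Saturated

/-- The total size of the formulas in a sequent. -/
noncomputable def weight : Sequent →+ ℕ where
  toFun S := (S.left.map sizeOf).sum + (S.right.map sizeOf).sum
  map_zero' := rfl
  map_add' S T := by
    change ((S.left + T.left).map sizeOf).sum + ((S.right + T.right).map sizeOf).sum = _
    simp only [Multiset.map_add, Multiset.sum_add]
    abel

theorem weight_apply (S : Sequent) :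
    weight S = (S.left.map sizeOf).sum + (S.right.map sizeOf).sum :=
  rfl

theorem weight_onLeft (A : Formula) : weight (onLeft A) = sizeOf A := by
  simp [weight_apply, onLeft]

theorem weight_onRight (A : Formula) : weight (onRight A) = sizeOf A := by
  simp [weight_apply, onRight]

/-- A part `E` of sequents is reducible if any unprovable `U + E` stays unprovable after replacing
`E` by some lighter sequent, of value at least that of `E` so that refuting the new sequent refutes
`U + E`. -/
def Reducible (E : Sequent) : Prop :=
  ∀ U, ¬ GAs (U + E) → ∃ E', ¬ GAs (U + E') ∧ weight E' < weight E ∧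
    ∀ (G : Type) [AddCommGroup G] [LinearOrder G] [IsOrderedAddMonoid G] (v : ℕ → G),
      E.value (Formula.eval v) ≤ E'.value (Formula.eval v)

namespace Reducible

variable {E E' : Sequent} {A B : Formula}

theorem of_derives (h : E'.Derives E) (weight_lt : weight E' < weight E)
    (value_eq : ∀ (G : Type) [AddCommGroup G] [LinearOrder G] [IsOrderedAddMonoid G] (v : ℕ → G),
      E.value (Formula.eval v) = E'.value (Formula.eval v)) : Reducible E :=
  fun U hU => ⟨E', mt (h U) hU, weight_lt, fun G _ _ _ v => (value_eq G v).le⟩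

theorem id (A : Formula) : Reducible ({A} ⊢ₛ {A}) := by
  refine of_derives (.of_GAs (GAs.id A)) ?_ fun G _ _ _ v => ?_
  · rw [← onLeft_add_onRight, map_zero, map_add, weight_onLeft]
    cases A <;> simp
  · simp [← onLeft_add_onRight, value_onLeft, value_onRight]

theorem onLeft_t : Reducible (onLeft .t) :=
  of_derives (.of_GAs (GAs.t_left 0 0 GAs.empty)) (by simp [weight_onLeft])
    fun G _ _ _ v => by simp [value_onLeft, Formula.eval]

theorem onRight_t : Reducible (onRight .t) :=
  of_derives (.of_GAs (GAs.t_right 0 0 GAs.empty)) (by simp [weight_onRight])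
    fun G _ _ _ v => by simp [value_onRight, Formula.eval]

theorem onLeft_neg : Reducible (onLeft A.neg) :=
  of_derives .neg_left (by simp [weight_onLeft, weight_onRight])
    fun G _ _ _ v => by simp [value_onLeft, value_onRight, Formula.eval]

theorem onRight_neg : Reducible (onRight A.neg) :=
  of_derives .neg_right (by simp [weight_onLeft, weight_onRight])
    fun G _ _ _ v => by simp [value_onLeft, value_onRight, Formula.eval]

theorem onLeft_add : Reducible (onLeft (A.add B)) :=
  of_derives .add_left
    (by simp only [map_add, weight_onLeft, Formula.add.sizeOf_spec]; lia)
    fun G _ _ _ v => by simp [value_onLeft, Formula.eval]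

theorem onRight_add : Reducible (onRight (A.add B)) :=
  of_derives .add_right
    (by simp only [map_add, weight_onRight, Formula.add.sizeOf_spec]; lia)
    fun G _ _ _ v => by simp [value_onRight, Formula.eval, add_comm]

theorem onLeft_imp : Reducible (onLeft (A.imp B)) :=
  of_derives .imp_left
    (by simp only [map_add, weight_onLeft, weight_onRight, Formula.imp.sizeOf_spec]; lia)
    fun G _ _ _ v => by simp [value_onLeft, value_onRight, Formula.eval]

theorem onRight_imp : Reducible (onRight (A.imp B)) :=
  of_derives .imp_right
    (by simp only [map_add, weight_onLeft, weight_onRight, Formula.imp.sizeOf_spec]; lia)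
    fun G _ _ _ v => by simp [value_onLeft, value_onRight, Formula.eval]

theorem onRight_pimp : Reducible (onRight (A.pimp B)) := by
  intro U hU
  by_cases h : GAs U
  · refine ⟨onLeft A + onRight B, fun h' => hU ?_, ?_, fun G _ _ _ v => ?_⟩
    · rw [← add_assoc, ← mk_cons_left, ← mk_cons_right] at h'
      rw [← mk_cons_right]
      exact GAs.pimp_right _ _ _ _ h h'
    · simp only [map_add, weight_onLeft, weight_onRight, Formula.pimp.sizeOf_spec]
      lia
    · rw [map_add, value_onLeft, value_onRight, value_onRight]
      exact inf_le_left
  · refine ⟨0, by rwa [add_zero], by simp [weight_onRight], fun G _ _ _ v => ?_⟩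
    rw [map_zero, value_onRight]
    exact inf_le_right

end Reducible

/-- No part of the sequent is reducible. -/
def Irreducible (S : Sequent) : Prop :=
  ∀ U E, S = U + E → ¬ Reducible E

namespace Irreducible

variable {S : Sequent} (hS : Irreducible S) {A : Formula}
include hS

theorem not_reducible_onLeft (hA : A ∈ S.left) : ¬ Reducible (onLeft A) := by
  obtain ⟨Γ, hΓ⟩ := Multiset.exists_cons_of_mem hA
  exact hS (Γ ⊢ₛ S.right) _ (by rw [← mk_cons_left, ← hΓ])

theorem not_reducible_onRight (hA : A ∈ S.right) : ¬ Reducible (onRight A) := by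
  obtain ⟨Δ, hΔ⟩ := Multiset.exists_cons_of_mem hA
  exact hS (S.left ⊢ₛ Δ) _ (by rw [← mk_cons_right, ← hΔ])

theorem var_or_pimp_of_mem_left (hA : A ∈ S.left) :
    (∃ n, A = .var n) ∨ ∃ B D : Formula, A = B.pimp D := by
  cases A with
  | var n => exact .inl ⟨n, rfl⟩
  | t => exact (hS.not_reducible_onLeft hA .onLeft_t).elim
  | neg A => exact (hS.not_reducible_onLeft hA .onLeft_neg).elim
  | add A B => exact (hS.not_reducible_onLeft hA .onLeft_add).elim
  | imp A B => exact (hS.not_reducible_onLeft hA .onLeft_imp).elim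
  | pimp A B => exact .inr ⟨A, B, rfl⟩

theorem var_of_mem_right (hA : A ∈ S.right) : ∃ n, A = .var n := by
  cases A with
  | var n => exact ⟨n, rfl⟩
  | t => exact (hS.not_reducible_onRight hA .onRight_t).elim
  | neg A => exact (hS.not_reducible_onRight hA .onRight_neg).elim
  | add A B => exact (hS.not_reducible_onRight hA .onRight_add).elim
  | imp A B => exact (hS.not_reducible_onRight hA .onRight_imp).elim
  | pimp A B => exact (hS.not_reducible_onRight hA .onRight_pimp).elim

theorem notMem_right_of_mem_left (hA : A ∈ S.left) : A ∉ S.right := by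
  intro hA'
  obtain ⟨Γ, hΓ⟩ := Multiset.exists_cons_of_mem hA
  obtain ⟨Δ, hΔ⟩ := Multiset.exists_cons_of_mem hA'
  refine hS (Γ ⊢ₛ Δ) ({A} ⊢ₛ {A}) ?_ (.id A)
  rw [← onLeft_add_onRight, ← add_assoc, ← mk_cons_left, ← mk_cons_right, ← hΓ, ← hΔ]

open Classical in
theorem value_single {C : AddSubmonoid Sequent} (hC : Saturated S C) {p : ℕ}
    (hp : {Formula.var p} ∉ domain C) (a : ℤ) :
    S.value (Formula.eval (Pi.single p a)) =
      (S.right.count (.var p) : ℤ) * a - S.left.count (.var p) * a := by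
  have eval_var_ne {n : ℕ} (hn : Formula.var n ≠ .var p) :
      (Formula.var n).eval (Pi.single p a : ℕ → ℤ) = 0 :=
    Pi.single_eq_of_ne (fun h : n = p => hn (congrArg _ h)) _
  have left_zero : ∀ A, A ≠ .var p → A ∈ S.left → A.eval (Pi.single p a : ℕ → ℤ) = 0 := by
    intro A hAp hA
    rcases hS.var_or_pimp_of_mem_left hA with ⟨n, rfl⟩ | ⟨B, D, rfl⟩
    · exact eval_var_ne hAp
    · obtain ⟨hB, hD⟩ := hC.mem_domain_of_pimp_mem hA
      simp [Formula.eval, hC.eval_single_eq_zero_of_mem_domain hp a hB,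
        hC.eval_single_eq_zero_of_mem_domain hp a hD]
  have right_zero : ∀ A, A ≠ .var p → A ∈ S.right → A.eval (Pi.single p a : ℕ → ℤ) = 0 := by
    intro A hAp hA
    obtain ⟨n, rfl⟩ := hS.var_of_mem_right hA
    exact eval_var_ne hAp
  rw [value_apply, Multiset.sum_map_eq_nsmul_single (.var p) right_zero,
    Multiset.sum_map_eq_nsmul_single (.var p) left_zero]
  simp [Formula.eval]

theorem refutable (h : ¬ GAs S) : S.Refutable := by
  classical
  obtain ⟨C, hC⟩ := exists_saturated h
  by_cases hvar : ∀ p, .var p ∈ S.left ∨ .var p ∈ S.right → {Formula.var p} ∈ domain C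
  · refine hC.refutable (fun A hA => ?_) fun A hA => ?_
    · refine (hS.var_or_pimp_of_mem_left hA).imp_left ?_
      rintro ⟨n, rfl⟩
      exact hvar n (.inl hA)
    · obtain ⟨n, rfl⟩ := hS.var_of_mem_right hA
      exact hvar n (.inr hA)
  · push Not at hvar
    obtain ⟨p, hp_mem, hp⟩ := hvar
    set l := S.left.count (.var p)
    set r := S.right.count (.var p)
    have l_ne_r : (l : ℤ) ≠ r := by
      rcases hp_mem with hpl | hpr
      · have := Multiset.count_pos.2 hpl
        have := Multiset.count_eq_zero.2 (hS.notMem_right_of_mem_left hpl)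
        lia
      · have := Multiset.count_pos.2 hpr
        have := Multiset.count_eq_zero.2 fun hpl => hS.notMem_right_of_mem_left hpl hpr
        lia
    refine ⟨ℤ, _, _, inferInstance, Pi.single p (l - r), ?_⟩
    rw [hS.value_single hC hp]
    nlinarith [sq_pos_of_ne_zero (sub_ne_zero.2 l_ne_r)]

end Irreducible

theorem refutable_of_not_GAs (S : Sequent) (h : ¬ GAs S) : S.Refutable := by
  induction hw : weight S using Nat.strong_induction_on generalizing S with
  | _ w ih =>
  subst hw
  by_cases hS : Irreducible S
  · exact hS.refutable h
  · simp only [Irreducible, not_forall, not_not] at hS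
    obtain ⟨U, E, rfl, hE⟩ := hS
    obtain ⟨E', hE', weight_lt, value_le⟩ := hE U h
    obtain ⟨G, _, _, _, v, value_neg⟩ := ih (weight (U + E')) (by simpa) (U + E') hE' rfl
    refine ⟨G, _, ‹_›, ‹_›, v, lt_of_le_of_lt ?_ value_neg⟩
    rw [map_add, map_add]
    gcongr
    exact value_le G v

end Sequent

theorem GAs.of_valid {S : Sequent} (h : Sequent.Valid.{u} S) : GAs S := by
  by_contra hS
  exact (refutable_of_not_GAs S hS).not_valid h

end AbelianLogic

/-- Soundness and completeness of `GA_s` for abelian logic. -/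
theorem mainTheorem11 (S : AbelianLogic.Sequent) :
    AbelianLogic.GAs S ↔ AbelianLogic.Sequent.Valid.{u} S :=
  ⟨AbelianLogic.GAs.valid, AbelianLogic.GAs.of_valid⟩
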